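/- Let $l\ge 1$ be an integer. For integers $n_1,\dots,n_l\ge 0$ put $N_j=n_j+n_{j+1}+\dots+n_l$ $(1\le j\le l)$, and let $(q)_m=(1-q)(1-q^2)\cdots(1-q^m)$, $(q)_0=1$. Then $$\prod_{\substack{n\ge 1\\ n\not\equiv 0,\pm(l+2)\ (\mathrm{mod}\ 2l+3)}}(1-q^n)^{-1}=\sum_{n_1,\dots,n_l\ge 0}\frac{q^{N_1^2+N_2^2+\dots+N_l^2}}{(q)_{n_1}(q)_{n_2}\cdots(q)_{n_l}}.$$ The identity holds in the ring $\mathbb{Z}[[q]]$ of formal power series, where the product and the sum converge coefficientwise (each coefficient is eventually constant), and also for every complex number $q$ with $|q|<1$, where the product converges unconditionally and the multiple series converges absolutely. -/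

import Mathlib

open scoped PowerSeries PowerSeries.WithPiTopology

/-- The finite `q`-factorial `(q)_m = (1 - q)(1 - q ^ 2) ⋯ (1 - q ^ m)`, with `(q)_0 = 1`. -/
def qFactorial {R : Type*} [CommRing R] (q : R) (m : ℕ) : R :=
  ∏ i ∈ Finset.range m, (1 - q ^ (i + 1))

/-- The positive integers `n` with `n ≢ 0, ±(l + 2) (mod 2 * l + 3)`. -/
def andrewsIndex (l : ℕ) : Set ℕ :=
  {n : ℕ | 1 ≤ n ∧ ¬ (n : ℤ) ≡ 0 [ZMOD 2 * l + 3] ∧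
    ¬ (n : ℤ) ≡ l + 2 [ZMOD 2 * l + 3] ∧ ¬ (n : ℤ) ≡ -(l + 2) [ZMOD 2 * l + 3]}

/-- The tail sum `N_j = n_j + n_{j+1} + ⋯ + n_l`; the indices `1, …, l` are
represented by the elements `0, …, l - 1` of `Fin l`. -/
def tailSum {l : ℕ} (n : Fin l → ℕ) (j : Fin l) : ℕ :=
  ∑ i ∈ Finset.Ici j, n i

/-- The exponent `N_1 ^ 2 + N_2 ^ 2 + ⋯ + N_l ^ 2`. -/
def sumSqTails {l : ℕ} (n : Fin l → ℕ) : ℕ :=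
  ∑ j, tailSum n j ^ 2

/-- The formal inverse in `ℤ⟦X⟧` of a power series whose constant coefficient is `1`. -/
noncomputable def formalInv (f : ℤ⟦X⟧) : ℤ⟦X⟧ :=
  PowerSeries.invOfUnit f 1

theorem mul_formalInv (f : ℤ⟦X⟧) (hf : PowerSeries.constantCoeff f = 1) :
    f * formalInv f = 1 :=
  PowerSeries.mul_invOfUnit f 1 (by simpa using hf)

theorem constantCoeff_one_sub_X_pow {n : ℕ} (hn : 1 ≤ n) :
    PowerSeries.constantCoeff (1 - PowerSeries.X ^ n : ℤ⟦X⟧) = 1 := by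
  have : n ≠ 0 := by omega
  simp [this]

theorem constantCoeff_qFactorial_X (m : ℕ) :
    PowerSeries.constantCoeff (qFactorial (PowerSeries.X : ℤ⟦X⟧) m) = 1 := by
  simp [qFactorial, map_prod]

/-! One sequence, `baileyBeta q (l + 1) n`, is computed in two ways. Unfolding the iteration turns
it into an `l`-fold sum, with `n_1, …, n_l` the successive differences of the nested summation
indices (`baileyBeta_succ_eq_tsum_multiTerm`). Alternatively, Bailey's lemma (`sum_bailey`) says
that each iteration merely multiplies the coefficient of `1 / ((q)_{n+r} (q)_{n-r})` by `q ^ (r ^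
2)`, which gives a bilateral theta sum (`baileyBeta_eq_tsum`).

As `n → ∞`, the multiple series divided by `(q)_∞` equals `θ / (q)_∞ ^ 2`, where `θ` is the theta
series with `a = q ^ (l + 1)`, `b = q ^ (l + 2)`. The Jacobi triple product factors `θ` over the
residue classes `0, l + 1, l + 2` modulo `2 * l + 3`, so `θ / (q)_∞` is the product over the
remaining classes. The finite triple product serves twice: at `a = 1` it is the unit Bailey pair,
and its limit is the triple product itself.

All this takes place in a complete normed commutative ring with `‖q‖ < 1`. It is applied to `ℂ` and
to `ℤ⟦X⟧` with the `X`-adic norm; the latter result is then carried to the coefficientwise topology.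
-/

open Filter Topology

set_option linter.unusedSectionVars false

/-! ### Reciprocal `q`-factorials and their limit -/

section NormedRing

variable {R : Type*} [NormedCommRing R] [NormOneClass R] [CompleteSpace R]

/-- The reciprocal `1 / (q)_m` for an integer index, with the value `0` at negative indices. -/
noncomputable def qInv (q : R) (m : ℤ) : R :=
  if 0 ≤ m then Ring.inverse (qFactorial q m.toNat) else 0

theorem qInv_of_neg (q : R) {m : ℤ} (hm : m < 0) : qInv q m = 0 := by
  simp [qInv, hm]

theorem qInv_natCast (q : R) (m : ℕ) : qInv q m = Ring.inverse (qFactorial q m) := by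
  simp [qInv]

theorem qInv_zero (q : R) : qInv q 0 = 1 := by
  simp [qInv, qFactorial]

theorem norm_pow_lt_one {q : R} (hq : ‖q‖ < 1) {n : ℕ} (hn : n ≠ 0) : ‖q ^ n‖ < 1 :=
  (norm_pow_le q n).trans_lt (pow_lt_one₀ (norm_nonneg q) hq hn)

theorem isUnit_one_sub_pow {q : R} (hq : ‖q‖ < 1) {n : ℕ} (hn : n ≠ 0) :
    IsUnit (1 - q ^ n) :=
  isUnit_one_sub_of_norm_lt_one (norm_pow_lt_one hq hn)

theorem isUnit_qFactorial {q : R} (hq : ‖q‖ < 1) (m : ℕ) : IsUnit (qFactorial q m) := by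
  rw [qFactorial, IsUnit.prod_iff]
  exact fun i _ => isUnit_one_sub_pow hq i.succ_ne_zero

theorem inverse_prod {ι M : Type*} [CommMonoidWithZero M] (s : Finset ι) (f : ι → M) :
    Ring.inverse (∏ i ∈ s, f i) = ∏ i ∈ s, Ring.inverse (f i) := by
  classical
  induction s using Finset.induction_on with
  | empty => simp
  | insert a s ha ih => rw [Finset.prod_insert ha, Finset.prod_insert ha, Ring.mul_inverse_rev, ih,
      mul_comm]

/-- The convention at negative indices makes this recurrence valid for every integer: at `m = 0` the
factor is `1 - 1`, and below that both sides vanish. Later recurrences therefore need few boundary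
cases. -/
theorem qInv_mul {q : R} (hq : ‖q‖ < 1) (m : ℤ) :
    qInv q m * (1 - q ^ m.toNat) = qInv q (m - 1) := by
  rcases lt_trichotomy m 0 with hm | rfl | hm
  · rw [qInv_of_neg q hm, qInv_of_neg q (by omega), zero_mul]
  · simp [qInv]
  · obtain ⟨k, rfl⟩ : ∃ k : ℕ, m = (k + 1 : ℕ) := ⟨(m - 1).toNat, by omega⟩
    have h : ((k + 1 : ℕ) : ℤ) - 1 = (k : ℕ) := by simp
    rw [h, qInv_natCast, qInv_natCast, Int.toNat_natCast, qFactorial, Finset.prod_range_succ,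
      Ring.mul_inverse_rev, mul_comm, ← mul_assoc,
      Ring.mul_inverse_cancel _ (isUnit_one_sub_pow hq k.succ_ne_zero), one_mul, qFactorial]

theorem norm_inverse_one_sub_sub_one_le {q : R} (hq : ‖q‖ < 1) {n : ℕ} (hn : n ≠ 0) :
    ‖Ring.inverse (1 - q ^ n) - 1‖ ≤ ‖q‖ ^ n * (1 - ‖q‖)⁻¹ := by
  have ht := norm_pow_lt_one hq hn
  have hle : ‖q ^ n‖ ≤ ‖q‖ ^ n := norm_pow_le q n
  have hle' : ‖q‖ ^ n ≤ ‖q‖ := pow_le_of_le_one (norm_nonneg q) hq.le hn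
  have h1 : Ring.inverse (1 - q ^ n) - 1 = q ^ n * Ring.inverse (1 - q ^ n) := by
    have := Ring.mul_inverse_cancel _ (isUnit_one_sub_pow hq hn)
    linear_combination this
  have h2 : ‖Ring.inverse (1 - q ^ n)‖ ≤ (1 - ‖q‖)⁻¹ := by
    rw [← geom_series_eq_inverse _ ht]
    refine (tsum_geometric_le_of_norm_lt_one _ ht).trans ?_
    rw [norm_one, sub_self, zero_add]
    exact inv_anti₀ (by linarith) (by linarith)
  rw [h1]
  exact (norm_mul_le _ _).trans (mul_le_mul hle h2 (norm_nonneg _) (by positivity))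

theorem multipliable_inverse_one_sub_pow {q : R} (hq : ‖q‖ < 1) {ι : Type*} {e : ι → ℕ}
    (he : Function.Injective e) (he0 : ∀ i, e i ≠ 0) :
    Multipliable fun i => Ring.inverse (1 - q ^ e i) := by
  have hs : Summable fun i => ‖Ring.inverse (1 - q ^ e i) - 1‖ :=
    Summable.of_nonneg_of_le (fun _ => norm_nonneg _)
      (fun i => norm_inverse_one_sub_sub_one_le hq (he0 i))
      (((summable_geometric_of_lt_one (norm_nonneg q) hq).comp_injective he).mul_right _)
  simpa using multipliable_one_add_of_summable hs

/-- The infinite product `1 / (q)_∞`. -/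
noncomputable def qInvInf (q : R) : R := ∏' n : ℕ, Ring.inverse (1 - q ^ (n + 1))

theorem hasProd_qInvInf {q : R} (hq : ‖q‖ < 1) :
    HasProd (fun n : ℕ => Ring.inverse (1 - q ^ (n + 1))) (qInvInf q) :=
  (multipliable_inverse_one_sub_pow hq (add_left_injective 1)
    (fun n => n.succ_ne_zero)).hasProd

theorem tendsto_qInv_natCast {q : R} (hq : ‖q‖ < 1) :
    Tendsto (fun n : ℕ => qInv q n) atTop (𝓝 (qInvInf q)) := by
  simpa only [qInv_natCast, qFactorial, inverse_prod] using (hasProd_qInvInf hq).tendsto_prod_nat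

theorem tendsto_qInv {q : R} (hq : ‖q‖ < 1) : Tendsto (qInv q) atTop (𝓝 (qInvInf q)) := by
  have h : Tendsto Int.toNat atTop atTop :=
    tendsto_atTop.2 fun b => (eventually_ge_atTop (b : ℤ)).mono fun a ha => by omega
  refine ((tendsto_qInv_natCast hq).comp h).congr' ?_
  filter_upwards [eventually_ge_atTop 0] with a ha
  simp [ha]

theorem exists_norm_qInv_le {q : R} (hq : ‖q‖ < 1) :
    ∃ C : ℝ, 0 ≤ C ∧ ∀ m : ℤ, ‖qInv q m‖ ≤ C := by
  obtain ⟨C, hC⟩ := (Metric.isBounded_range_of_tendsto _ (tendsto_qInv_natCast hq)).exists_norm_le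
  refine ⟨max C 0, le_max_right _ _, fun m => ?_⟩
  rcases lt_or_ge m 0 with hm | hm
  · simp [qInv_of_neg q hm]
  · lift m to ℕ using hm
    exact (hC _ ⟨m, rfl⟩).trans (le_max_left _ _)

/-- The inverse is `∏ (1 - q ^ (n + 1))`, since the two products cancel factor by factor. `R` need
not be a field or a domain, so later cancellations rely on units. -/
theorem isUnit_qInvInf {q : R} (hq : ‖q‖ < 1) : IsUnit (qInvInf q) := by
  have hs : Summable fun n : ℕ => ‖-q ^ (n + 1)‖ :=
    Summable.of_nonneg_of_le (fun _ => norm_nonneg _)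
      (fun n => by rw [norm_neg]; exact norm_pow_le q _)
      ((summable_nat_add_iff 1).2 (summable_geometric_of_lt_one (norm_nonneg q) hq))
  have h := (multipliable_one_add_of_summable hs).hasProd.mul (hasProd_qInvInf hq)
  have h1 : ∀ n : ℕ, (1 + -q ^ (n + 1)) * Ring.inverse (1 - q ^ (n + 1)) = 1 := fun n => by
    rw [← sub_eq_add_neg, Ring.mul_inverse_cancel _ (isUnit_one_sub_pow hq n.succ_ne_zero)]
  simp only [h1] at h
  exact .of_mul_eq_one_right _ (h.unique hasProd_one)

end NormedRing

/-! ### Theta series and the Jacobi triple product -/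

section Theta

variable {R : Type*} [NormedCommRing R] [NormOneClass R] [CompleteSpace R]

/-- The triangular number `r (r + 1) / 2` of an integer. -/
def triangle (r : ℤ) : ℕ := (r * (r + 1) / 2).toNat

theorem triangle_cast_mul_two (r : ℤ) : (triangle r : ℤ) * 2 = r * (r + 1) := by
  have h2 : 2 ∣ r * (r + 1) := (Int.even_mul_succ_self r).two_dvd
  have h0 : 0 ≤ r * (r + 1) := by
    rcases le_or_gt 0 r with h | h
    · positivity
    · nlinarith
  rw [triangle, Int.toNat_of_nonneg (Int.ediv_nonneg h0 (by norm_num)), Int.ediv_mul_cancel h2]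

theorem triangle_add_one (r : ℤ) : (triangle (r + 1) : ℤ) = triangle r + (r + 1) := by
  have h1 := triangle_cast_mul_two r
  have h2 := triangle_cast_mul_two (r + 1)
  linarith

theorem triangle_add_triangle_neg (r : ℤ) : triangle r + triangle (-r) = r.natAbs ^ 2 := by
  have h1 := triangle_cast_mul_two r
  have h2 := triangle_cast_mul_two (-r)
  zify
  rw [sq_abs]
  linarith

/-- The terms `(-1) ^ r a ^ (r (r + 1) / 2) b ^ (r (r - 1) / 2)` of Ramanujan's theta series. -/
def thetaTerm (a b : R) (r : ℤ) : R :=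
  (-1) ^ r.natAbs * a ^ triangle r * b ^ triangle (-r)

theorem thetaTerm_zero (a b : R) : thetaTerm a b 0 = 1 := by
  simp [thetaTerm, triangle]

theorem thetaTerm_neg (a b : R) (r : ℤ) : thetaTerm a b (-r) = thetaTerm b a r := by
  simp only [thetaTerm, Int.natAbs_neg, neg_neg]
  ring

theorem neg_one_pow_natAbs_add_one (r : ℤ) :
    (-1 : R) ^ (r + 1).natAbs = -(-1) ^ r.natAbs := by
  rcases le_or_gt 0 r with h | h
  · rw [show (r + 1).natAbs = r.natAbs + 1 by omega, pow_succ]; ring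
  · rw [show r.natAbs = (r + 1).natAbs + 1 by omega, pow_succ]; ring

/-- Consecutive terms have formal ratio `-a (a b) ^ r`; the extra power of `a * b` clears negative
exponents. -/
theorem thetaTerm_add_one_mul (a b : R) (r : ℤ) (n : ℕ) (hr : r ≤ n) :
    thetaTerm a b (r + 1) * (a * b) ^ (n - r).toNat
      = -(a * (a * b) ^ n) * thetaTerm a b r := by
  have hA : triangle (r + 1) + (n - r).toNat = n + 1 + triangle r := by
    have := triangle_add_one r
    omega
  have hB : triangle (-(r + 1)) + (n - r).toNat = n + triangle (-r) := by
    have := triangle_add_one (-(r + 1))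
    rw [show -(r + 1) + 1 = -r by ring] at this
    omega
  simp only [thetaTerm, neg_one_pow_natAbs_add_one, mul_pow]
  calc _ = -(-1) ^ r.natAbs * (a ^ triangle (r + 1) * a ^ (n - r).toNat)
        * (b ^ triangle (-(r + 1)) * b ^ (n - r).toNat) := by ring
    _ = _ := by rw [← pow_add, ← pow_add, hA, hB]; ring

/-- The terms of the finite form of the Jacobi triple product. -/
noncomputable def thetaFinTerm (a b : R) (m n : ℕ) (r : ℤ) : R :=
  thetaTerm a b r * (qInv (a * b) (m + r) * qInv (a * b) (n - r))

theorem summable_mul_qInv_mul_qInv (q : R) (f : ℤ → R) (m n : ℤ) :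
    Summable fun r : ℤ => f r * (qInv q (m + r) * qInv q (n - r)) := by
  refine summable_of_hasFiniteSupport ((Set.finite_Icc (-m) n).subset fun r hr => ?_)
  by_contra h
  rw [Set.mem_Icc, not_and_or, not_le, not_le] at h
  rcases h with h | h
  · exact hr (by simp [qInv_of_neg q (show m + r < 0 by omega)])
  · exact hr (by simp [qInv_of_neg q (show n - r < 0 by omega)])

theorem summable_thetaFinTerm (a b : R) (m n : ℕ) : Summable (thetaFinTerm a b m n) := by
  unfold thetaFinTerm
  exact summable_mul_qInv_mul_qInv (a * b) (thetaTerm a b) (m : ℤ) (n : ℤ)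

/-- A `q`-Pascal rule. With `Q = a b`, split `1 - Q ^ (m+n+1)` as `(1 - Q ^ (n+1-r)) + Q ^ (n+1-r)
(1 - Q ^ (m+r))`; each bracket lowers one reciprocal factorial, and the loose power of `Q` turns the
theta term at `r` into the one at `r - 1`. -/
theorem thetaFinTerm_succ_right {a b : R} (h : ‖a * b‖ < 1) (m n : ℕ) (r : ℤ) :
    thetaFinTerm a b m (n + 1) r * (1 - (a * b) ^ (m + n + 1))
      = thetaFinTerm a b m n r + -(a * (a * b) ^ n) * thetaFinTerm a b m n (r - 1) := by
  set Q := a * b with hQ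
  have e1 : qInv Q (n + 1 - r) * (1 - Q ^ (n + 1 - r).toNat) = qInv Q (n - r) := by
    rw [qInv_mul h]; congr 1; ring
  have e2 : qInv Q (m + r) * (1 - Q ^ (m + r).toNat) = qInv Q (m + (r - 1)) := by
    rw [qInv_mul h]; congr 1; ring
  simp only [thetaFinTerm, ← hQ, Nat.cast_add, Nat.cast_one]
  rw [show (n : ℤ) - (r - 1) = n + 1 - r by ring]
  rcases lt_or_ge ((m : ℤ) + r) 0 with hm | hm
  · rw [qInv_of_neg Q hm, qInv_of_neg Q (show (m : ℤ) + (r - 1) < 0 by omega)]; ring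
  rcases lt_or_ge ((n : ℤ) + 1 - r) 0 with hn | hn
  · rw [qInv_of_neg Q hn, qInv_of_neg Q (show (n : ℤ) - r < 0 by omega)]; ring
  have e3 : Q ^ (m + n + 1) = Q ^ (n + 1 - r).toNat * Q ^ (m + r).toNat := by
    rw [← pow_add]; congr 1; omega
  have e4 : thetaTerm a b r * Q ^ (n + 1 - r).toNat
      = -(a * Q ^ n) * thetaTerm a b (r - 1) := by
    have := thetaTerm_add_one_mul a b (r - 1) n (by omega)
    rwa [show r - 1 + 1 = r by ring, show (n : ℤ) - (r - 1) = n + 1 - r by ring] at this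
  rw [← e1, ← e2, e3]
  linear_combination qInv Q (m + r) * (1 - Q ^ (m + r).toNat) * qInv Q (n + 1 - r) * e4

theorem tsum_thetaFinTerm_succ_right {a b : R} (h : ‖a * b‖ < 1) (m n : ℕ) :
    (∑' r, thetaFinTerm a b m (n + 1) r) * (1 - (a * b) ^ (m + n + 1))
      = (1 - a * (a * b) ^ n) * ∑' r, thetaFinTerm a b m n r := by
  have hs := summable_thetaFinTerm a b m n
  have hs' : Summable fun r => thetaFinTerm a b m n (r - 1) :=
    hs.comp_injective (sub_left_injective (b := (1 : ℤ)))
  have hs1 := summable_thetaFinTerm a b m (n + 1)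
  have hshift : ∑' r, thetaFinTerm a b m n (r - 1) = ∑' r, thetaFinTerm a b m n r :=
    (Equiv.subRight (1 : ℤ)).tsum_eq (thetaFinTerm a b m n)
  calc (∑' r, thetaFinTerm a b m (n + 1) r) * (1 - (a * b) ^ (m + n + 1))
      = ∑' r, thetaFinTerm a b m (n + 1) r * (1 - (a * b) ^ (m + n + 1)) :=
        (hs1.tsum_mul_right _).symm
    _ = ∑' r, (thetaFinTerm a b m n r + -(a * (a * b) ^ n) * thetaFinTerm a b m n (r - 1)) :=
        tsum_congr fun r => thetaFinTerm_succ_right h m n r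
    _ = (∑' r, thetaFinTerm a b m n r)
          + ∑' r, -(a * (a * b) ^ n) * thetaFinTerm a b m n (r - 1) :=
        hs.tsum_add (hs'.mul_left _)
    _ = _ := by rw [hs'.tsum_mul_left, hshift]; ring

theorem qFactorial_mul_tsum_thetaFinTerm {a b : R} (h : ‖a * b‖ < 1) (m n : ℕ) :
    qFactorial (a * b) (m + n) * ∑' r, thetaFinTerm a b m n r
      = (∏ i ∈ Finset.range n, (1 - a * (a * b) ^ i))
        * (qFactorial (a * b) m * ∑' r, thetaFinTerm a b m 0 r) := by
  induction n with
  | zero => simp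
  | succ n ih =>
    rw [← add_assoc, qFactorial, Finset.prod_range_succ, ← qFactorial, Finset.prod_range_succ]
    linear_combination (1 - a * (a * b) ^ n) * ih
      + qFactorial (a * b) (m + n) * tsum_thetaFinTerm_succ_right h m n

/-- The reflection `r ↦ -r` exchanges `(a, m)` with `(b, n)`, so the recurrence in `n` also handles
`m`. -/
theorem tsum_thetaFinTerm_comm (a b : R) (m n : ℕ) :
    ∑' r, thetaFinTerm a b m n r = ∑' r, thetaFinTerm b a n m r := by
  rw [← tsum_comp_neg]
  refine tsum_congr fun r => ?_
  rw [thetaFinTerm, thetaFinTerm, thetaTerm_neg, mul_comm b a, sub_neg_eq_add, ← sub_eq_add_neg,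
    mul_comm (qInv _ _)]

theorem tsum_thetaFinTerm_zero_zero (a b : R) : ∑' r, thetaFinTerm a b 0 0 r = 1 := by
  rw [tsum_eq_single 0]
  · simp [thetaFinTerm, thetaTerm_zero, qInv_zero]
  · intro r hr
    rcases lt_or_gt_of_ne hr with h | h
    · simp [thetaFinTerm, qInv_of_neg _ h]
    · simp [thetaFinTerm, qInv_of_neg (a * b) (show -r < 0 by omega)]

/-- The finite form of the Jacobi triple product identity. -/
theorem qFactorial_mul_tsum_thetaFinTerm_eq_prod {a b : R} (h : ‖a * b‖ < 1) (m n : ℕ) :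
    qFactorial (a * b) (m + n) * ∑' r, thetaFinTerm a b m n r
      = (∏ i ∈ Finset.range n, (1 - a * (a * b) ^ i))
        * ∏ i ∈ Finset.range m, (1 - b * (a * b) ^ i) := by
  have h' : ‖b * a‖ < 1 := by rwa [mul_comm]
  have := qFactorial_mul_tsum_thetaFinTerm h' 0 m
  rw [tsum_thetaFinTerm_zero_zero, zero_add, mul_comm b a] at this
  rw [qFactorial_mul_tsum_thetaFinTerm h, tsum_thetaFinTerm_comm a b m 0, this]
  simp [qFactorial]

theorem summable_pow_natAbs_sq {x : ℝ} (h0 : 0 ≤ x) (h1 : x < 1) :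
    Summable fun r : ℤ => x ^ r.natAbs ^ 2 := by
  have h : Summable fun n : ℕ => x ^ n ^ 2 :=
    Summable.of_nonneg_of_le (fun n => by positivity)
      (fun n => pow_le_pow_of_le_one h0 h1.le (Nat.le_self_pow two_ne_zero n))
      (summable_geometric_of_lt_one h0 h1)
  exact Summable.of_nat_of_neg (by simpa using h) (by simpa using h)

/-- Passage to the limit in sums over `ℤ` weighted by `1 / ((q)_{n+r} (q)_{n-r})`. -/
theorem tendsto_tsum_mul_qInv_mul_qInv {q : R} (hq : ‖q‖ < 1) {f : ℤ → R} {x : ℝ} (h0 : 0 ≤ x)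
    (h1 : x < 1) (hf : ∀ r, ‖f r‖ ≤ x ^ r.natAbs ^ 2) :
    Tendsto (fun n : ℕ => ∑' r, f r * (qInv q (n + r) * qInv q (n - r))) atTop
      (𝓝 ((∑' r, f r) * qInvInf q ^ 2)) := by
  obtain ⟨C, hC0, hC⟩ := exists_norm_qInv_le hq
  have hsf : Summable f := .of_norm_bounded (summable_pow_natAbs_sq h0 h1) hf
  rw [← hsf.tsum_mul_right]
  refine tendsto_tsum_of_dominated_convergence
    (bound := fun r : ℤ => x ^ r.natAbs ^ 2 * (C * C))
    ((summable_pow_natAbs_sq h0 h1).mul_right _) (fun r => ?_) (.of_forall fun n r => ?_)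
  · have l1 : Tendsto (fun n : ℕ => (n : ℤ) + r) atTop atTop :=
      tendsto_atTop_add_const_right _ _ tendsto_natCast_atTop_atTop
    have l2 : Tendsto (fun n : ℕ => (n : ℤ) - r) atTop atTop :=
      tendsto_atTop_add_const_right _ _ tendsto_natCast_atTop_atTop
    rw [sq]
    exact (((tendsto_qInv hq).comp l1).mul ((tendsto_qInv hq).comp l2)).const_mul _
  · refine (norm_mul_le _ _).trans (mul_le_mul (hf r) ((norm_mul_le _ _).trans
      (mul_le_mul (hC _) (hC _) (norm_nonneg _) hC0)) (norm_nonneg _) (by positivity))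

/-- The two triangular exponents add up to `r ^ 2`, which supplies the dominating series for the
limits. -/
theorem norm_thetaTerm_le (a b : R) (r : ℤ) :
    ‖thetaTerm a b r‖ ≤ max ‖a‖ ‖b‖ ^ r.natAbs ^ 2 := by
  rw [← triangle_add_triangle_neg, pow_add, thetaTerm, mul_assoc]
  have hn : ‖(-1 : R) ^ r.natAbs‖ ≤ 1 := (norm_pow_le _ _).trans (by simp)
  refine (norm_mul_le _ _).trans ((mul_le_of_le_one_left (norm_nonneg _) hn).trans ?_)
  refine (norm_mul_le _ _).trans (mul_le_mul ?_ ?_ (norm_nonneg _) (by positivity))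
  · exact (norm_pow_le _ _).trans (pow_le_pow_left₀ (norm_nonneg _) (le_max_left _ _) _)
  · exact (norm_pow_le _ _).trans (pow_le_pow_left₀ (norm_nonneg _) (le_max_right _ _) _)

theorem multipliable_one_sub_mul_pow {c q : R} (hq : ‖q‖ < 1) :
    Multipliable fun i : ℕ => 1 - c * q ^ i := by
  have hs : Summable fun i : ℕ => ‖-(c * q ^ i)‖ :=
    Summable.of_nonneg_of_le (fun _ => norm_nonneg _)
      (fun n => by
        rw [norm_neg]
        exact (norm_mul_le _ _).trans
          (mul_le_mul_of_nonneg_left (norm_pow_le q n) (norm_nonneg _)))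
      ((summable_geometric_of_lt_one (norm_nonneg q) hq).mul_left ‖c‖)
  simpa [sub_eq_add_neg] using multipliable_one_add_of_summable hs

/-- The Jacobi triple product identity. -/
theorem tsum_thetaTerm_mul_qInvInf {a b : R} (ha : ‖a‖ < 1) (hb : ‖b‖ < 1) :
    (∑' r, thetaTerm a b r) * qInvInf (a * b)
      = (∏' i : ℕ, (1 - a * (a * b) ^ i)) * ∏' i : ℕ, (1 - b * (a * b) ^ i) := by
  have hQ : ‖a * b‖ < 1 :=
    (norm_mul_le a b).trans_lt (mul_lt_one_of_nonneg_of_lt_one_left (norm_nonneg a) ha hb.le)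
  have lim1 := tendsto_tsum_mul_qInv_mul_qInv hQ (le_max_of_le_left (norm_nonneg a))
    (max_lt ha hb) (norm_thetaTerm_le a b)
  have h2n : Tendsto (fun n : ℕ => ((n + n : ℕ) : ℤ)) atTop atTop :=
    tendsto_natCast_atTop_atTop.comp
      (tendsto_atTop_mono (fun n => Nat.le_add_left n n) tendsto_id)
  have lim2 := ((tendsto_qInv hQ).comp h2n).mul
    ((multipliable_one_sub_mul_pow (c := a) hQ).tendsto_prod_tprod_nat.mul
      (multipliable_one_sub_mul_pow (c := b) hQ).tendsto_prod_tprod_nat)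
  -- The finite identity with `m = n`, divided by `(a b; a b)_{2n}`; its two sides are the sequences
  -- in `lim1` and `lim2`.
  have heq : ∀ n : ℕ,
      ∑' r, thetaTerm a b r * (qInv (a * b) (n + r) * qInv (a * b) (n - r))
        = (qInv (a * b) ∘ fun n : ℕ => ((n + n : ℕ) : ℤ)) n *
          ((∏ i ∈ Finset.range n, (1 - a * (a * b) ^ i))
            * ∏ i ∈ Finset.range n, (1 - b * (a * b) ^ i)) := fun n => by
    rw [← qFactorial_mul_tsum_thetaFinTerm_eq_prod hQ, Function.comp_apply, qInv_natCast,
      ← mul_assoc, Ring.inverse_mul_cancel _ (isUnit_qFactorial hQ _), one_mul]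
    rfl
  have := tendsto_nhds_unique (lim1.congr heq) lim2
  refine (isUnit_qInvInf hQ).mul_left_cancel ?_
  rw [← this]
  ring

end Theta

/-! ### Bailey's lemma and the Bailey chain -/

section Bailey

variable {R : Type*} [NormedCommRing R] [NormOneClass R] [CompleteSpace R]

/-- Write `1 - q ^ (m+1) = (1 - q ^ j) + q ^ j (1 - q ^ (m+1-j))`. After shifting `j` in the first
part, the two parts recombine through `q ^ (j+s+1) + (1 - q ^ (j+s+1)) = 1`. The parameters become
`(m, s + 1)`, hence the induction on `m` for all `s`. -/
theorem sum_qVandermonde_succ {q : R} (hq : ‖q‖ < 1) (m s : ℕ) :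
    (∑ j ∈ Finset.range (m + 2),
        q ^ (j * (j + s)) * (qInv q ((m + 1 : ℕ) - j) * qInv q j * qInv q (j + s)))
          * (1 - q ^ (m + 1))
      = ∑ j ∈ Finset.range (m + 1),
        q ^ (j * (j + (s + 1))) * (qInv q (m - j) * qInv q j * qInv q (j + (s + 1 : ℕ))) := by
  have hterm : ∀ j ∈ Finset.range (m + 2),
      q ^ (j * (j + s)) * (qInv q ((m + 1 : ℕ) - j) * qInv q j * qInv q (j + s))
          * (1 - q ^ (m + 1))
        = q ^ (j * (j + s)) * (qInv q ((m + 1 : ℕ) - j) * qInv q (j - 1) * qInv q (j + s))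
          + q ^ (j * (j + (s + 1))) * (qInv q (m - j) * qInv q j * qInv q (j + s)) := by
    intro j hj
    have hj' : j ≤ m + 1 := Nat.lt_succ_iff.1 (Finset.mem_range.1 hj)
    have e1 := qInv_mul hq (j : ℤ)
    have e2 := qInv_mul hq ((m + 1 : ℕ) - j : ℤ)
    rw [Int.toNat_natCast] at e1
    rw [show ((m + 1 : ℕ) - j : ℤ).toNat = m + 1 - j by omega,
      show ((m + 1 : ℕ) - j : ℤ) - 1 = m - j by push_cast; ring] at e2
    have e3 : q ^ (m + 1) = q ^ j * q ^ (m + 1 - j) := by rw [← pow_add]; congr 1; omega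
    rw [e3, ← e1, ← e2]
    ring
  have hrec : ∀ j : ℕ, qInv q (j + s) = qInv q (j + (s + 1 : ℕ)) * (1 - q ^ (j + s + 1)) := by
    intro j
    have := qInv_mul hq (j + (s + 1 : ℕ) : ℤ)
    rw [show (j + (s + 1 : ℕ) : ℤ).toNat = j + s + 1 by omega,
      show (j + (s + 1 : ℕ) : ℤ) - 1 = j + s by push_cast; ring] at this
    exact this.symm
  rw [Finset.sum_mul, Finset.sum_congr rfl hterm, Finset.sum_add_distrib,
    Finset.sum_range_succ' _ (m + 1), Finset.sum_range_succ _ (m + 1),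
    qInv_of_neg q (show ((0 : ℕ) : ℤ) - 1 < 0 by simp),
    qInv_of_neg q (show (m : ℤ) - (m + 1 : ℕ) < 0 by simp)]
  simp only [zero_mul, mul_zero, add_zero]
  rw [← Finset.sum_add_distrib]
  refine Finset.sum_congr rfl fun j _ => ?_
  rw [hrec j, show ((m + 1 : ℕ) : ℤ) - (j + 1 : ℕ) = m - j by push_cast; ring,
    show ((j + 1 : ℕ) : ℤ) - 1 = j by simp,
    show ((j + 1 : ℕ) : ℤ) + s = j + (s + 1 : ℕ) by push_cast; ring,
    show (j + 1) * (j + 1 + s) = j * (j + (s + 1)) + (j + s + 1) by ring, pow_add]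
  ring

/-- A limiting case of the `q`-Vandermonde summation. -/
theorem sum_qVandermonde {q : R} (hq : ‖q‖ < 1) (m s : ℕ) :
    ∑ j ∈ Finset.range (m + 1),
        q ^ (j * (j + s)) * (qInv q (m - j) * qInv q j * qInv q (j + s))
      = qInv q m * qInv q (m + s) := by
  induction m generalizing s with
  | zero => simp [qInv_zero]
  | succ m ih =>
    have hu : IsUnit (1 - q ^ (m + 1)) := isUnit_one_sub_pow hq m.succ_ne_zero
    refine hu.mul_right_cancel ?_
    rw [sum_qVandermonde_succ hq m s, ih (s + 1)]
    have := qInv_mul hq ((m + 1 : ℕ) : ℤ)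
    rw [Int.toNat_natCast, show ((m + 1 : ℕ) : ℤ) - 1 = m by simp] at this
    rw [← this, show (m : ℤ) + (s + 1 : ℕ) = (m + 1 : ℕ) + s by push_cast; ring]
    ring

/-- Terms with `k < r` vanish. Putting `k = r + j` gives `k ^ 2 = r ^ 2 + j (j + 2 r)`, and the rest
is `sum_qVandermonde` with `s = 2 r`. -/
theorem sum_bailey_natCast {q : R} (hq : ‖q‖ < 1) (n r : ℕ) :
    ∑ k ∈ Finset.range (n + 1),
        q ^ k ^ 2 * (qInv q (n - k) * (qInv q (k + r) * qInv q (k - r)))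
      = q ^ r ^ 2 * (qInv q (n + r) * qInv q (n - r)) := by
  rcases lt_or_ge n r with h | h
  · rw [qInv_of_neg q (show (n : ℤ) - r < 0 by omega)]
    simp only [mul_zero]
    refine Finset.sum_eq_zero fun k hk => ?_
    rw [Finset.mem_range] at hk
    simp [qInv_of_neg q (show (k : ℤ) - r < 0 by omega)]
  · obtain ⟨m, rfl⟩ := Nat.exists_eq_add_of_le h
    have hz : ∑ k ∈ Finset.range r, q ^ k ^ 2 *
        (qInv q ((r + m : ℕ) - k) * (qInv q (k + r) * qInv q (k - r))) = 0 := by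
      refine Finset.sum_eq_zero fun k hk => ?_
      rw [Finset.mem_range] at hk
      simp [qInv_of_neg q (show (k : ℤ) - r < 0 by omega)]
    have hv := sum_qVandermonde hq m (2 * r)
    rw [add_assoc, Finset.sum_range_add, hz, zero_add,
      show ((r + m : ℕ) : ℤ) + r = m + (2 * r : ℕ) by push_cast; ring,
      show ((r + m : ℕ) : ℤ) - r = m by push_cast; ring, mul_comm (qInv q (m + _)), ← hv,
      Finset.mul_sum]
    refine Finset.sum_congr rfl fun j _ => ?_
    rw [show ((r + m : ℕ) : ℤ) - (r + j : ℕ) = m - j by push_cast; ring,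
      show ((r + j : ℕ) : ℤ) + r = j + (2 * r : ℕ) by push_cast; ring,
      show ((r + j : ℕ) : ℤ) - r = j by push_cast; ring,
      show (r + j) ^ 2 = r ^ 2 + j * (j + 2 * r) by ring, pow_add]
    ring

theorem sum_bailey {q : R} (hq : ‖q‖ < 1) (n : ℕ) (r : ℤ) :
    ∑ k ∈ Finset.range (n + 1),
        q ^ k ^ 2 * (qInv q (n - k) * (qInv q (k + r) * qInv q (k - r)))
      = q ^ r.natAbs ^ 2 * (qInv q (n + r) * qInv q (n - r)) := by
  obtain ⟨s, rfl | rfl⟩ := r.eq_nat_or_neg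
  · simpa using sum_bailey_natCast hq n s
  · simpa [sub_eq_add_neg, mul_comm, mul_left_comm, mul_assoc] using sum_bailey_natCast hq n s

/-- The `β`-side of the Bailey chain that starts from the unit Bailey pair. -/
noncomputable def baileyBeta (q : R) : ℕ → ℕ → R
  | 0, n => if n = 0 then 1 else 0
  | j + 1, n => ∑ k ∈ Finset.range (n + 1), q ^ k ^ 2 * (qInv q (n - k) * baileyBeta q j k)

/-- At `a = 1` the factor `i = 0` of the finite triple product is `1 - 1`, which kills the sum
unless `n = 0`. -/
theorem tsum_unit_bailey_pair {q : R} (hq : ‖q‖ < 1) (n : ℕ) :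
    ∑' r, thetaTerm 1 q r * (qInv q (n + r) * qInv q (n - r)) = if n = 0 then 1 else 0 := by
  have h := qFactorial_mul_tsum_thetaFinTerm_eq_prod (a := 1) (b := q) (by simpa using hq) n n
  simp only [thetaFinTerm, one_mul] at h
  split_ifs with hn
  · subst hn
    simpa [qFactorial] using h
  · refine (isUnit_qFactorial hq (n + n)).mul_left_cancel ?_
    rw [h, mul_zero, Finset.prod_eq_zero (Finset.mem_range.2 (Nat.pos_of_ne_zero hn)) (by simp),
      zero_mul]

/-- The summation in `baileyBeta` acts diagonally: by `sum_bailey` it reproduces each kernel `1 /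
((q)_{n+r} (q)_{n-r})` times `q ^ (r ^ 2)`. -/
theorem baileyBeta_eq_tsum {q : R} (hq : ‖q‖ < 1) (j n : ℕ) :
    baileyBeta q j n = ∑' r, thetaTerm 1 q r * q ^ (j * r.natAbs ^ 2)
      * (qInv q (n + r) * qInv q (n - r)) := by
  induction j generalizing n with
  | zero => simp [baileyBeta, tsum_unit_bailey_pair hq]
  | succ j ih =>
    have hs : ∀ k : ℕ, Summable fun r : ℤ => thetaTerm 1 q r * q ^ (j * r.natAbs ^ 2)
        * (qInv q (k + r) * qInv q (k - r)) := fun k => summable_mul_qInv_mul_qInv _ _ _ _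
    calc baileyBeta q (j + 1) n
        = ∑ k ∈ Finset.range (n + 1), ∑' r : ℤ, q ^ k ^ 2 * (qInv q (n - k) *
            (thetaTerm 1 q r * q ^ (j * r.natAbs ^ 2) * (qInv q (k + r) * qInv q (k - r)))) := by
          rw [baileyBeta]
          refine Finset.sum_congr rfl fun k _ => ?_
          rw [ih, ((hs k).mul_left _).tsum_mul_left, (hs k).tsum_mul_left]
      _ = ∑' r : ℤ, ∑ k ∈ Finset.range (n + 1), q ^ k ^ 2 * (qInv q (n - k) *
            (thetaTerm 1 q r * q ^ (j * r.natAbs ^ 2) * (qInv q (k + r) * qInv q (k - r)))) :=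
          (Summable.tsum_finsetSum fun k _ => ((hs k).mul_left _).mul_left _).symm
      _ = _ := by
          refine tsum_congr fun r => ?_
          rw [add_mul, one_mul, pow_add]
          rw [mul_assoc (thetaTerm 1 q r), mul_assoc (q ^ (j * r.natAbs ^ 2)), ← sum_bailey hq,
            Finset.mul_sum, Finset.mul_sum]
          exact Finset.sum_congr rfl fun k _ => by ring

/-! ### The multiple series as an unfolded Bailey chain -/

theorem tailSum_cons_zero {l : ℕ} (a : ℕ) (v : Fin l → ℕ) :
    tailSum (Fin.cons a v : Fin (l + 1) → ℕ) 0 = a + ∑ i, v i := by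
  have : Finset.Ici (0 : Fin (l + 1)) = Finset.univ := by ext; simp
  rw [tailSum, this, Fin.sum_cons]

theorem tailSum_cons_succ {l : ℕ} (a : ℕ) (v : Fin l → ℕ) (j : Fin l) :
    tailSum (Fin.cons a v : Fin (l + 1) → ℕ) j.succ = tailSum v j := by
  have : Finset.Ici j.succ = (Finset.Ici j).map (Fin.succEmb l) := by
    ext i
    refine Fin.cases ?_ (fun i => ?_) i
    · simp
    · simp
  rw [tailSum, this, Finset.sum_map]
  simp [tailSum]

theorem sumSqTails_cons {l : ℕ} (a : ℕ) (v : Fin l → ℕ) :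
    sumSqTails (Fin.cons a v : Fin (l + 1) → ℕ) = (a + ∑ i, v i) ^ 2 + sumSqTails v := by
  simp [sumSqTails, Fin.sum_univ_succ, tailSum_cons_zero, tailSum_cons_succ]

theorem sum_le_sumSqTails {l : ℕ} (v : Fin l → ℕ) : ∑ i, v i ≤ sumSqTails v := by
  refine Finset.sum_le_sum fun i _ => ?_
  calc v i ≤ tailSum v i := Finset.single_le_sum (f := v) (fun _ _ => Nat.zero_le _)
        (Finset.mem_Ici.2 le_rfl)
    _ ≤ _ := Nat.le_self_pow two_ne_zero _

/-- The terms of the multiple series, with the reciprocals written through `qInv`. -/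
noncomputable def multiTerm {l : ℕ} (q : R) (v : Fin l → ℕ) : R :=
  q ^ sumSqTails v * ∏ i, qInv q (v i)

theorem multiTerm_cons {l : ℕ} (q : R) (a : ℕ) (v : Fin l → ℕ) :
    multiTerm q (Fin.cons a v : Fin (l + 1) → ℕ)
      = q ^ (a + ∑ i, v i) ^ 2 * qInv q a * multiTerm q v := by
  simp only [multiTerm, sumSqTails_cons, Fin.prod_univ_succ, Fin.cons_zero, Fin.cons_succ, pow_add]
  ring

theorem summable_pow_sum {x : ℝ} (h0 : 0 ≤ x) (h1 : x < 1) (l : ℕ) :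
    Summable fun v : Fin l → ℕ => x ^ ∑ i, v i := by
  induction l with
  | zero => exact .of_finite
  | succ l ih =>
    rw [← (Fin.consEquiv fun _ : Fin (l + 1) => ℕ).summable_iff]
    refine ((summable_geometric_of_lt_one h0 h1).mul_of_nonneg ih (fun _ => pow_nonneg h0 _)
      (fun _ => pow_nonneg h0 _)).congr fun p => ?_
    simp [Fin.consEquiv, Fin.sum_univ_succ, pow_add]

theorem norm_multiTerm_le {q : R} (hq : ‖q‖ < 1) {C : ℝ} (hC : ∀ m, ‖qInv q m‖ ≤ C) {l : ℕ}
    (v : Fin l → ℕ) : ‖multiTerm q v‖ ≤ ‖q‖ ^ (∑ i, v i) * C ^ l := by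
  refine (norm_mul_le _ _).trans (mul_le_mul ?_ ?_ (norm_nonneg _) (by positivity))
  · exact (norm_pow_le _ _).trans
      (pow_le_pow_of_le_one (norm_nonneg _) hq.le (sum_le_sumSqTails v))
  · refine (Finset.norm_prod_le _ _).trans ((Finset.prod_le_prod (fun _ _ => norm_nonneg _)
      fun i _ => hC (v i)).trans ?_)
    simp

theorem norm_multiTerm_mul_qInv_le {q : R} (hq : ‖q‖ < 1) {C : ℝ} (hC0 : 0 ≤ C)
    (hC : ∀ m, ‖qInv q m‖ ≤ C) {l : ℕ} (v : Fin l → ℕ) (m : ℤ) :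
    ‖multiTerm q v * qInv q m‖ ≤ ‖q‖ ^ (∑ i, v i) * (C ^ l * C) := by
  rw [← mul_assoc]
  exact (norm_mul_le _ _).trans (mul_le_mul (norm_multiTerm_le hq hC v) (hC m) (norm_nonneg _)
    (by positivity))

theorem summable_multiTerm {q : R} (hq : ‖q‖ < 1) (l : ℕ) :
    Summable fun v : Fin l → ℕ => multiTerm q v := by
  obtain ⟨C, -, hC⟩ := exists_norm_qInv_le hq
  exact .of_norm_bounded ((summable_pow_sum (norm_nonneg q) hq l).mul_right _)
    (norm_multiTerm_le hq hC)

theorem summable_multiTerm_mul_qInv {q : R} (hq : ‖q‖ < 1) {l : ℕ} (m : (Fin l → ℕ) → ℤ) :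
    Summable fun v : Fin l → ℕ => multiTerm q v * qInv q (m v) := by
  obtain ⟨C, hC0, hC⟩ := exists_norm_qInv_le hq
  exact .of_norm_bounded ((summable_pow_sum (norm_nonneg q) hq l).mul_right _)
    fun v => norm_multiTerm_mul_qInv_le hq hC0 hC v _

/-- The substitution `k = a + s`; vanishing at negative indices makes the ranges agree. -/
theorem sum_range_eq_tsum_shift (q : R) (n s : ℕ) :
    ∑ k ∈ Finset.range (n + 1), q ^ k ^ 2 * (qInv q (n - k) * qInv q (k - s))
      = ∑' a : ℕ, q ^ (a + s) ^ 2 * qInv q a * qInv q (n - (a + s : ℕ)) := by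
  rw [tsum_eq_sum (s := Finset.range (n + 1)) fun a ha => by
    rw [Finset.mem_range] at ha
    rw [qInv_of_neg q (show (n : ℤ) - (a + s : ℕ) < 0 by omega), mul_zero]]
  rcases lt_or_ge n s with h | h
  · rw [Finset.sum_eq_zero fun k hk => ?_, Finset.sum_eq_zero fun k hk => ?_]
    · rw [qInv_of_neg q (show (n : ℤ) - (k + s : ℕ) < 0 by omega), mul_zero]
    · rw [Finset.mem_range] at hk
      rw [qInv_of_neg q (show (k : ℤ) - s < 0 by omega), mul_zero, mul_zero]
  · obtain ⟨m, rfl⟩ := Nat.exists_eq_add_of_le h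
    have hz : ∑ k ∈ Finset.range s,
        q ^ k ^ 2 * (qInv q ((s + m : ℕ) - k) * qInv q (k - s)) = 0 :=
      Finset.sum_eq_zero fun k hk => by
        rw [Finset.mem_range] at hk
        rw [qInv_of_neg q (show (k : ℤ) - s < 0 by omega), mul_zero, mul_zero]
    have hz' : ∑ k ∈ Finset.range s, q ^ (m + 1 + k + s) ^ 2 * qInv q (m + 1 + k : ℕ)
        * qInv q ((s + m : ℕ) - (m + 1 + k + s : ℕ)) = 0 :=
      Finset.sum_eq_zero fun k _ => by
        rw [qInv_of_neg q (show ((s + m : ℕ) : ℤ) - (m + 1 + k + s : ℕ) < 0 by omega), mul_zero]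
    rw [add_assoc, Finset.sum_range_add _ s (m + 1), hz, zero_add, add_comm s (m + 1),
      Finset.sum_range_add _ (m + 1) s, hz', add_zero]
    refine Finset.sum_congr rfl fun j _ => ?_
    rw [add_comm j s, show ((s + j : ℕ) : ℤ) - s = j by push_cast; ring]
    ring

/-- The outermost index `k` plays the role of `N_1`, and `a = k - N_2` is the new variable `n_1`.
Only `l` variables arise from `l + 1` steps, because the first step applied to the unit pair just
gives `1 / (q)_n`. -/
theorem baileyBeta_succ_eq_tsum_multiTerm {q : R} (hq : ‖q‖ < 1) (l n : ℕ) :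
    baileyBeta q (l + 1) n
      = ∑' v : Fin l → ℕ, multiTerm q v * qInv q (n - (∑ i, v i : ℕ)) := by
  induction l generalizing n with
  | zero =>
    rw [baileyBeta, Finset.sum_range_succ', tsum_eq_single default fun v hv =>
      (hv (Subsingleton.elim _ _)).elim]
    simp [baileyBeta, multiTerm, sumSqTails]
  | succ l ih =>
    have hs : ∀ k : ℕ, Summable fun v : Fin l → ℕ =>
        multiTerm q v * qInv q (k - (∑ i, v i : ℕ)) :=
      fun k => summable_multiTerm_mul_qInv hq _
    -- The tail `v` is the outer variable, so that the inner sum runs over the head `a`.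
    let e : (Fin l → ℕ) × ℕ ≃ (Fin (l + 1) → ℕ) :=
      (Equiv.prodComm _ _).trans (Fin.consEquiv fun _ : Fin (l + 1) => ℕ)
    have he : ∀ v a, e (v, a) = Fin.cons a v := fun _ _ => rfl
    have hs' : Summable fun p : (Fin l → ℕ) × ℕ =>
        multiTerm q (e p) * qInv q (n - (∑ i, e p i : ℕ)) :=
      (summable_multiTerm_mul_qInv hq
        fun v : Fin (l + 1) → ℕ => (n - (∑ i, v i : ℕ) : ℤ)).comp_injective e.injective
    rw [← e.tsum_eq, hs'.tsum_prod]
    calc baileyBeta q (l + 1 + 1) n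
        = ∑ k ∈ Finset.range (n + 1), ∑' v : Fin l → ℕ, q ^ k ^ 2 * (qInv q (n - k) *
            (multiTerm q v * qInv q (k - (∑ i, v i : ℕ)))) := by
          rw [baileyBeta]
          refine Finset.sum_congr rfl fun k _ => ?_
          rw [ih, ((hs k).mul_left _).tsum_mul_left, (hs k).tsum_mul_left]
      _ = ∑' v : Fin l → ℕ, ∑ k ∈ Finset.range (n + 1), q ^ k ^ 2 * (qInv q (n - k) *
            (multiTerm q v * qInv q (k - (∑ i, v i : ℕ)))) :=
          (Summable.tsum_finsetSum fun k _ => ((hs k).mul_left _).mul_left _).symm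
      _ = _ := by
          refine tsum_congr fun v => ?_
          calc _ = (∑ k ∈ Finset.range (n + 1),
                  q ^ k ^ 2 * (qInv q (n - k) * qInv q (k - (∑ i, v i : ℕ)))) * multiTerm q v := by
                rw [Finset.sum_mul]
                exact Finset.sum_congr rfl fun k _ => by ring
            _ = _ := by
                rw [sum_range_eq_tsum_shift, ← Summable.tsum_mul_right]
                · refine tsum_congr fun a => ?_
                  rw [he, multiTerm_cons, Fin.sum_cons]
                  ring
                · refine summable_of_hasFiniteSupport ((Set.finite_Iic n).subset fun a ha => ?_)
                  by_contra h
                  rw [Set.mem_Iic, not_le] at h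
                  have hneg : (n : ℤ) - (a + ∑ i, v i : ℕ) < 0 := by
                    rw [Nat.cast_add]
                    omega
                  exact ha (by simp only [qInv_of_neg q hneg, mul_zero])

theorem tendsto_baileyBeta_multi {q : R} (hq : ‖q‖ < 1) (l : ℕ) :
    Tendsto (baileyBeta q (l + 1)) atTop
      (𝓝 ((∑' v : Fin l → ℕ, multiTerm q v) * qInvInf q)) := by
  obtain ⟨C, hC0, hC⟩ := exists_norm_qInv_le hq
  rw [← (summable_multiTerm hq l).tsum_mul_right]
  simp only [funext (baileyBeta_succ_eq_tsum_multiTerm hq l)]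
  refine tendsto_tsum_of_dominated_convergence
    ((summable_pow_sum (norm_nonneg q) hq l).mul_right (C ^ l * C)) (fun v => ?_)
    (.of_forall fun n v => norm_multiTerm_mul_qInv_le hq hC0 hC v _)
  exact ((tendsto_qInv hq).comp
    (tendsto_atTop_add_const_right _ _ tendsto_natCast_atTop_atTop)).const_mul _

/-- As `r ^ 2` is the sum of the two theta exponents, the factor `q ^ (l r ^ 2)` multiplies both
parameters by `q ^ l`. -/
theorem thetaTerm_one_mul_pow (q : R) (l : ℕ) (r : ℤ) :
    thetaTerm 1 q r * q ^ (l * r.natAbs ^ 2) = thetaTerm (q ^ l) (q ^ (l + 1)) r := by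
  simp only [thetaTerm, one_pow, mul_one, ← pow_mul, mul_assoc, ← pow_add,
    ← triangle_add_triangle_neg]
  congr 2
  ring

theorem tsum_multiTerm_eq_tsum_thetaTerm {q : R} (hq : ‖q‖ < 1) (l : ℕ) :
    ∑' v : Fin l → ℕ, multiTerm q v
      = qInvInf q * ∑' r, thetaTerm (q ^ (l + 1)) (q ^ (l + 2)) r := by
  have lim := tendsto_tsum_mul_qInv_mul_qInv hq
    (le_max_of_le_left (norm_nonneg (q ^ (l + 1))))
    (max_lt (norm_pow_lt_one hq l.succ_ne_zero) (norm_pow_lt_one hq (l + 1).succ_ne_zero))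
    (norm_thetaTerm_le (q ^ (l + 1)) (q ^ (l + 2)))
  have heq : ∀ n : ℕ, ∑' r, thetaTerm (q ^ (l + 1)) (q ^ (l + 2)) r
      * (qInv q (n + r) * qInv q (n - r)) = baileyBeta q (l + 1) n := fun n => by
    rw [baileyBeta_eq_tsum hq]
    exact tsum_congr fun r => by rw [thetaTerm_one_mul_pow]
  -- Both limits are of `baileyBeta q (l + 1)`; one carries `(q)_∞⁻²`, the other `(q)_∞⁻¹`.
  have := tendsto_nhds_unique (lim.congr heq) (tendsto_baileyBeta_multi hq l)
  refine (isUnit_qInvInf hq).mul_right_cancel ?_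
  rw [← this]
  ring

end Bailey

/-! ### Splitting the product by residues modulo `2 * l + 3` -/

section ProductSide

theorem mem_andrewsIndex_iff (l n : ℕ) :
    n ∈ andrewsIndex l ↔ 1 ≤ n ∧ n % (2 * l + 3) ≠ 0 ∧ n % (2 * l + 3) ≠ l + 1 ∧
      n % (2 * l + 3) ≠ l + 2 := by
  have h0 : (0 : ℤ) % (2 * l + 3) = 0 := by simp
  have h1 : ((l : ℤ) + 2) % (2 * l + 3) = l + 2 := Int.emod_eq_of_lt (by omega) (by omega)
  have h2 : (-((l : ℤ) + 2)) % (2 * l + 3) = l + 1 := by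
    rw [← Int.add_emod_right]
    rw [Int.emod_eq_of_lt] <;> omega
  have h3 : ((n : ℤ) % (2 * l + 3)) = (n % (2 * l + 3) : ℕ) := by push_cast; rfl
  simp only [andrewsIndex, Set.mem_ofPred_eq, Int.ModEq, h0, h1, h2, h3]
  omega

theorem mem_range_add_mul_iff {M r : ℕ} (hr : r < M) (n : ℕ) :
    n ∈ Set.range (fun i : ℕ => r + M * i) ↔ n % M = r := by
  constructor
  · rintro ⟨i, rfl⟩
    simp [Nat.add_mul_mod_self_left, Nat.mod_eq_of_lt hr]
  · intro h
    exact ⟨n / M, by simp only []; rw [← h, Nat.mod_add_div]⟩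

theorem mem_range_mul_succ_iff {M : ℕ} (hM : 0 < M) (n : ℕ) :
    n ∈ Set.range (fun i : ℕ => M * (i + 1)) ↔ 1 ≤ n ∧ n % M = 0 := by
  constructor
  · rintro ⟨i, rfl⟩
    exact ⟨Nat.mul_pos hM i.succ_pos, Nat.mul_mod_right _ _⟩
  · rintro ⟨h1, h⟩
    obtain ⟨k, rfl⟩ := Nat.dvd_of_mod_eq_zero h
    obtain ⟨i, rfl⟩ := Nat.exists_eq_succ_of_ne_zero (show k ≠ 0 by rintro rfl; simp at h1)
    exact ⟨i, rfl⟩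

variable {R : Type*} [NormedCommRing R] [NormOneClass R] [CompleteSpace R]

theorem multipliable_andrewsIndex {q : R} (hq : ‖q‖ < 1) (l : ℕ) :
    Multipliable fun n : andrewsIndex l => Ring.inverse (1 - q ^ (n : ℕ)) :=
  multipliable_inverse_one_sub_pow hq Subtype.val_injective
    fun n => (Nat.pos_iff_ne_zero.1 n.2.1)

theorem hasProd_range {q : R} (hq : ‖q‖ < 1) {e : ℕ → ℕ} (he : Function.Injective e)
    (he0 : ∀ i, e i ≠ 0) :
    HasProd ((fun n : ℕ => Ring.inverse (1 - q ^ n)) ∘ ((↑) : Set.range e → ℕ))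
      (∏' i, Ring.inverse (1 - q ^ e i)) := by
  have h := (multipliable_inverse_one_sub_pow hq he he0).hasProd
  exact (he.hasProd_range_iff (f := fun n : ℕ => Ring.inverse (1 - q ^ n))).2 h

theorem tprod_inverse_mul_tprod {q : R} (hq : ‖q‖ < 1) {M r : ℕ} (hr : r ≠ 0) (hM : M ≠ 0) :
    (∏' i : ℕ, Ring.inverse (1 - q ^ (r + M * i))) * ∏' i : ℕ, (1 - q ^ r * (q ^ M) ^ i) = 1 := by
  have hinj : Function.Injective fun i : ℕ => r + M * i := fun i j h => by
    simpa [hM] using h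
  have h0 : ∀ i : ℕ, r + M * i ≠ 0 := fun i => by omega
  have h := (multipliable_inverse_one_sub_pow hq hinj h0).hasProd.mul
    (multipliable_one_sub_mul_pow (c := q ^ r) (norm_pow_lt_one hq hM)).hasProd
  refine h.unique ?_
  convert hasProd_one (α := R) (β := ℕ) using 2 with i
  rw [← pow_mul, ← pow_add, Ring.inverse_mul_cancel _ (isUnit_one_sub_pow hq (h0 i))]

/-- The positive integers are the disjoint union of the index set and the classes `0`, `l + 1`, `l +
2`, where `l + 1 ≡ -(l + 2)`. -/
theorem tprod_andrewsIndex_mul {q : R} (hq : ‖q‖ < 1) (l : ℕ) :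
    (∏' n : andrewsIndex l, Ring.inverse (1 - q ^ (n : ℕ)))
        * qInvInf (q ^ (2 * l + 3))
        * (∏' i : ℕ, Ring.inverse (1 - q ^ (l + 1 + (2 * l + 3) * i)))
        * (∏' i : ℕ, Ring.inverse (1 - q ^ (l + 2 + (2 * l + 3) * i)))
      = qInvInf q := by
  have hM : 0 < 2 * l + 3 := by omega
  have inj : ∀ r : ℕ, Function.Injective fun i : ℕ => r + (2 * l + 3) * i := fun r i j h => by
    simpa using h
  have inj0 : Function.Injective fun i : ℕ => (2 * l + 3) * (i + 1) := fun i j h => by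
    simpa using h
  have p : HasProd ((fun n : ℕ => Ring.inverse (1 - q ^ n)) ∘ ((↑) : andrewsIndex l → ℕ))
      (∏' n : andrewsIndex l, Ring.inverse (1 - q ^ (n : ℕ))) :=
    (multipliable_andrewsIndex hq l).hasProd
  have p0 := hasProd_range hq inj0 fun i => by positivity
  have p1 := hasProd_range hq (inj (l + 1)) fun i => by omega
  have p2 := hasProd_range hq (inj (l + 2)) fun i => by omega
  have hpos := hasProd_range hq (add_left_injective 1) fun i => i.succ_ne_zero
  have m1 := mem_range_add_mul_iff (show l + 1 < 2 * l + 3 by omega)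
  have m2 := mem_range_add_mul_iff (show l + 2 < 2 * l + 3 by omega)
  have m0 := mem_range_mul_succ_iff hM
  have mA := mem_andrewsIndex_iff l
  have d0 : Disjoint (andrewsIndex l) (Set.range fun i : ℕ => (2 * l + 3) * (i + 1)) :=
    Set.disjoint_left.2 fun n h h' => by rw [mA] at h; rw [m0] at h'; omega
  have d1 : Disjoint (andrewsIndex l ∪ Set.range fun i : ℕ => (2 * l + 3) * (i + 1))
      (Set.range fun i : ℕ => l + 1 + (2 * l + 3) * i) :=
    Set.disjoint_left.2 fun n h h' => by
      rw [Set.mem_union, mA, m0] at h; rw [m1] at h'; omega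
  have d2 : Disjoint ((andrewsIndex l ∪ Set.range fun i : ℕ => (2 * l + 3) * (i + 1))
      ∪ Set.range fun i : ℕ => l + 1 + (2 * l + 3) * i)
      (Set.range fun i : ℕ => l + 2 + (2 * l + 3) * i) :=
    Set.disjoint_left.2 fun n h h' => by
      rw [Set.mem_union, Set.mem_union, mA, m0, m1] at h; rw [m2] at h'; omega
  have hU := ((p.mul_disjoint d0 p0).mul_disjoint d1 p1).mul_disjoint d2 p2
  have hset : ((andrewsIndex l ∪ Set.range fun i : ℕ => (2 * l + 3) * (i + 1))
      ∪ Set.range fun i : ℕ => l + 1 + (2 * l + 3) * i)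
      ∪ (Set.range fun i : ℕ => l + 2 + (2 * l + 3) * i) = Set.range fun i : ℕ => i + 1 := by
    ext n
    have hr : n ∈ (Set.range fun i : ℕ => i + 1) ↔ 1 ≤ n :=
      ⟨by rintro ⟨i, rfl⟩; simp, fun h => ⟨n - 1, by simp only []; omega⟩⟩
    rw [Set.mem_union, Set.mem_union, Set.mem_union, mA, m0, m1, m2, hr]
    rcases Nat.eq_zero_or_pos n with rfl | hn
    · simp
    · omega
  rw [hset] at hU
  have := hU.unique hpos
  simpa only [qInvInf, ← pow_mul] using this

/-- Andrews' identity in a complete normed commutative ring. -/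
theorem andrews_identity {q : R} (hq : ‖q‖ < 1) (l : ℕ) :
    ∏' n : andrewsIndex l, Ring.inverse (1 - q ^ (n : ℕ))
      = ∑' v : Fin l → ℕ, multiTerm q v := by
  have hM : (2 * l + 3) ≠ 0 := by omega
  have hab : q ^ (l + 1) * q ^ (l + 2) = q ^ (2 * l + 3) := by rw [← pow_add]; congr 1; ring
  have jtp := tsum_thetaTerm_mul_qInvInf (norm_pow_lt_one hq l.succ_ne_zero)
    (norm_pow_lt_one hq (l + 1).succ_ne_zero)
  rw [Nat.succ_eq_add_one, Nat.succ_eq_add_one, add_assoc, hab] at jtp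
  have i1 := tprod_inverse_mul_tprod hq l.succ_ne_zero hM
  have i2 := tprod_inverse_mul_tprod hq (l + 1).succ_ne_zero hM
  rw [Nat.succ_eq_add_one] at i1 i2
  rw [add_assoc] at i2
  have hprod := tprod_andrewsIndex_mul hq l
  rw [tsum_multiTerm_eq_tsum_thetaTerm hq]
  set P := ∏' n : andrewsIndex l, Ring.inverse (1 - q ^ (n : ℕ))
  set p1 := ∏' i : ℕ, Ring.inverse (1 - q ^ (l + 1 + (2 * l + 3) * i))
  set p2 := ∏' i : ℕ, Ring.inverse (1 - q ^ (l + 2 + (2 * l + 3) * i))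
  have hunit : IsUnit (qInvInf (q ^ (2 * l + 3)) * (p1 * p2)) :=
    (isUnit_qInvInf (norm_pow_lt_one hq hM)).mul
      ((IsUnit.of_mul_eq_one _ i1).mul (IsUnit.of_mul_eq_one _ i2))
  refine hunit.mul_right_cancel ?_
  set π1 := ∏' i : ℕ, (1 - q ^ (l + 1) * (q ^ (2 * l + 3)) ^ i)
  set π2 := ∏' i : ℕ, (1 - q ^ (l + 2) * (q ^ (2 * l + 3)) ^ i)
  -- The triple product reads `θ * qInvInf (q ^ (2 * l + 3)) = π1 * π2`, and `p1 * π1 = p2 * π2 =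
  -- 1`.
  linear_combination hprod - qInvInf q * p1 * p2 * jtp - qInvInf q * (p2 * π2) * i1
    - qInvInf q * i2

end ProductSide

/-! ### The `X`-adic norm and formal power series -/

section FormalSeries

/-- The ring `ℤ⟦X⟧`, to be equipped with the `X`-adic norm. -/
def AdicPowerSeries : Type := ℤ⟦X⟧

namespace AdicPowerSeries

noncomputable instance : CommRing AdicPowerSeries := inferInstanceAs (CommRing ℤ⟦X⟧)

/-- The `X`-adic norm `2 ^ (-order f)`. -/
noncomputable def adicNorm (f : ℤ⟦X⟧) : ℝ :=
  open Classical in if f = 0 then 0 else (1 / 2) ^ f.order.toNat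

theorem adicNorm_zero : adicNorm 0 = 0 := by simp [adicNorm]

theorem adicNorm_of_ne_zero {f : ℤ⟦X⟧} (hf : f ≠ 0) :
    adicNorm f = (1 / 2) ^ f.order.toNat := by simp [adicNorm, hf]

theorem adicNorm_neg (f : ℤ⟦X⟧) : adicNorm (-f) = adicNorm f := by
  rcases eq_or_ne f 0 with rfl | hf
  · rw [neg_zero]
  · rw [adicNorm_of_ne_zero hf, adicNorm_of_ne_zero (neg_ne_zero.2 hf), PowerSeries.order_neg]

theorem adicNorm_nonneg (f : ℤ⟦X⟧) : 0 ≤ adicNorm f := by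
  rw [adicNorm]; split_ifs <;> positivity

/-- Translates norm bounds into vanishing coefficients; the ultrametric inequality,
submultiplicativity and completeness all rest on it. -/
theorem adicNorm_le_iff (f : ℤ⟦X⟧) (n : ℕ) :
    adicNorm f ≤ (1 / 2) ^ n ↔ ∀ i < n, PowerSeries.coeff i f = 0 := by
  rcases eq_or_ne f 0 with rfl | hf
  · simp [adicNorm_zero]
  · rw [adicNorm_of_ne_zero hf, pow_le_pow_iff_right_of_lt_one₀ (by norm_num) (by norm_num)]
    constructor
    · exact fun h i hi => PowerSeries.coeff_of_lt_order_toNat i (hi.trans_le h)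
    · intro h
      by_contra hlt
      exact PowerSeries.coeff_order hf (h _ (not_le.1 hlt))

theorem adicNorm_add_le_max (f g : ℤ⟦X⟧) :
    adicNorm (f + g) ≤ max (adicNorm f) (adicNorm g) := by
  rcases eq_or_ne f 0 with rfl | hf
  · simp
  rcases eq_or_ne g 0 with rfl | hg
  · simp
  have key : ∀ n : ℕ, adicNorm f ≤ (1 / 2) ^ n → adicNorm g ≤ (1 / 2) ^ n →
      adicNorm (f + g) ≤ (1 / 2) ^ n := fun n h1 h2 => by
    rw [adicNorm_le_iff] at h1 h2 ⊢
    intro i hi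
    rw [map_add, h1 i hi, h2 i hi, add_zero]
  rcases le_total (adicNorm f) (adicNorm g) with h | h
  · rw [max_eq_right h]
    rw [adicNorm_of_ne_zero hg] at h ⊢
    exact key _ h (adicNorm_of_ne_zero hg).le
  · rw [max_eq_left h]
    rw [adicNorm_of_ne_zero hf] at h ⊢
    exact key _ (adicNorm_of_ne_zero hf).le h

theorem adicNorm_mul_le (f g : ℤ⟦X⟧) : adicNorm (f * g) ≤ adicNorm f * adicNorm g := by
  rcases eq_or_ne f 0 with rfl | hf
  · simp [adicNorm_zero]
  rcases eq_or_ne g 0 with rfl | hg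
  · simp [adicNorm_zero]
  rw [adicNorm_of_ne_zero hf, adicNorm_of_ne_zero hg, ← pow_add, adicNorm_le_iff,
    ← PowerSeries.X_pow_dvd_iff, pow_add]
  exact mul_dvd_mul PowerSeries.X_pow_order_dvd PowerSeries.X_pow_order_dvd

/-- The identity map to `ℤ⟦X⟧`. -/
noncomputable def toPowerSeries : AdicPowerSeries ≃+* ℤ⟦X⟧ := RingEquiv.refl ℤ⟦X⟧

/-- The `X`-adic norm on `ℤ⟦X⟧` as a ring norm. -/
noncomputable def ringNorm : RingNorm AdicPowerSeries where
  toFun f := adicNorm (toPowerSeries f)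
  map_zero' := by rw [map_zero, adicNorm_zero]
  add_le' f g := by
    rw [map_add]
    exact (adicNorm_add_le_max _ _).trans
      (max_le_add_of_nonneg (adicNorm_nonneg _) (adicNorm_nonneg _))
  neg' f := by
    rw [map_neg, adicNorm_neg]
  mul_le' f g := by
    rw [map_mul]
    exact adicNorm_mul_le _ _
  eq_zero_of_map_eq_zero' f h := by
    by_contra hf
    have hf' : toPowerSeries f ≠ 0 := fun h0 => hf (toPowerSeries.map_eq_zero_iff.1 h0)
    have h' : adicNorm (toPowerSeries f) = 0 := h
    rw [adicNorm_of_ne_zero hf'] at h'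
    exact absurd h' (by positivity)

noncomputable instance : NormedCommRing AdicPowerSeries where
  __ := ringNorm.toNormedRing
  mul_comm := mul_comm

theorem norm_def (f : AdicPowerSeries) : ‖f‖ = adicNorm (toPowerSeries f) := rfl

instance : NormOneClass AdicPowerSeries where
  norm_one := by
    rw [norm_def, map_one]
    simp [adicNorm]

theorem dist_le_iff (f g : AdicPowerSeries) (n : ℕ) :
    dist f g ≤ (1 / 2) ^ n ↔ ∀ i < n,
      PowerSeries.coeff i (toPowerSeries f) = PowerSeries.coeff i (toPowerSeries g) := by
  rw [dist_eq_norm, norm_def, adicNorm_le_iff, map_sub]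
  simp only [map_sub, sub_eq_zero]

/-- Each coefficient is locally constant: the ball of radius `2 ^ (-(i + 1))` fixes coefficient `i`.
Continuity in this direction suffices to push products and sums forward. -/
theorem continuous_toPowerSeries : Continuous toPowerSeries := by
  refine continuous_iff_continuousAt.2 fun f => ?_
  refine (PowerSeries.WithPiTopology.tendsto_iff_coeff_tendsto ℤ _ _ _).2 fun i => ?_
  refine tendsto_const_nhds.congr' ?_
  filter_upwards [Metric.closedBall_mem_nhds f (ε := (1 / 2) ^ (i + 1)) (by positivity)] with g hg
  exact ((dist_le_iff _ _ _).1 (Metric.mem_closedBall.1 hg) i i.lt_succ_self).symm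

instance : CompleteSpace AdicPowerSeries := by
  refine Metric.complete_of_convergent_controlled_sequences (fun n => (1 / 2) ^ n)
    (fun n => by positivity) fun u hu => ?_
  -- From index `i + 1` on, the sequence moves by less than `2 ^ (-(i + 1))`, so coefficient `i` no
  -- longer changes.
  let f : ℤ⟦X⟧ := PowerSeries.mk fun i => PowerSeries.coeff i (toPowerSeries (u (i + 1)))
  refine ⟨toPowerSeries.symm f, Metric.tendsto_atTop.2 fun ε hε => ?_⟩
  obtain ⟨N, hN⟩ := exists_pow_lt_of_lt_one hε (show (1 / 2 : ℝ) < 1 by norm_num)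
  refine ⟨N, fun n hn => lt_of_le_of_lt ((dist_le_iff _ _ N).2 fun i hi => ?_) hN⟩
  rw [RingEquiv.apply_symm_apply, PowerSeries.coeff_mk]
  exact (dist_le_iff _ _ _).1 (hu (i + 1) n (i + 1) (by omega) le_rfl).le i i.lt_succ_self

theorem norm_X_lt_one : ‖toPowerSeries.symm PowerSeries.X‖ < 1 := by
  refine lt_of_le_of_lt (b := (1 / 2) ^ 1) ?_ (by norm_num)
  rw [norm_def, adicNorm_le_iff, RingEquiv.apply_symm_apply]
  intro i hi
  obtain rfl : i = 0 := by omega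
  exact PowerSeries.coeff_zero_X

end AdicPowerSeries

theorem formalInv_eq_inverse {f : ℤ⟦X⟧} (hf : PowerSeries.constantCoeff f = 1) :
    formalInv f = Ring.inverse f := by
  have h := mul_formalInv f hf
  have hu : IsUnit f := IsUnit.of_mul_eq_one _ h
  exact hu.mul_left_cancel (h.trans (Ring.mul_inverse_cancel f hu).symm)

theorem RingEquiv.map_ringInverse {A B : Type*} [Semiring A] [Semiring B] (e : A ≃+* B) (x : A) :
    e (Ring.inverse x) = Ring.inverse (e x) := by
  by_cases h : IsUnit x
  · refine (h.map e).mul_left_cancel ?_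
    rw [← map_mul, Ring.mul_inverse_cancel _ h, Ring.mul_inverse_cancel _ (h.map e), map_one]
  · rw [Ring.inverse_non_unit _ h, map_zero, Ring.inverse_non_unit]
    rwa [MulEquiv.isUnit_map]

theorem map_qFactorial {A B : Type*} [CommRing A] [CommRing B] (e : A →+* B) (q : A) (m : ℕ) :
    e (qFactorial q m) = qFactorial (e q) m := by
  simp [qFactorial, map_prod]

theorem multiTerm_eq {R : Type*} [NormedCommRing R] [NormOneClass R] [CompleteSpace R] {l : ℕ}
    (q : R) (v : Fin l → ℕ) :
    multiTerm q v = q ^ sumSqTails v * Ring.inverse (∏ j, qFactorial q (v j)) := by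
  simp only [multiTerm, qInv_natCast, inverse_prod]

theorem andrews_identity_powerSeries (l : ℕ) :
    Multipliable (fun n : andrewsIndex l =>
        formalInv (1 - (PowerSeries.X : ℤ⟦X⟧) ^ (n : ℕ))) ∧
      Summable (fun n : Fin l → ℕ =>
        (PowerSeries.X : ℤ⟦X⟧) ^ sumSqTails n *
          formalInv (∏ j, qFactorial (PowerSeries.X : ℤ⟦X⟧) (n j))) ∧
      ∏' n : andrewsIndex l, formalInv (1 - (PowerSeries.X : ℤ⟦X⟧) ^ (n : ℕ)) =
        ∑' n : Fin l → ℕ, (PowerSeries.X : ℤ⟦X⟧) ^ sumSqTails n *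
          formalInv (∏ j, qFactorial (PowerSeries.X : ℤ⟦X⟧) (n j)) := by
  have hq := AdicPowerSeries.norm_X_lt_one
  set e := AdicPowerSeries.toPowerSeries
  have he : Continuous e := AdicPowerSeries.continuous_toPowerSeries
  set q := e.symm PowerSeries.X
  have heq : e q = PowerSeries.X := e.apply_symm_apply _
  have hp := (multipliable_andrewsIndex hq l).hasProd.map e he
  have hs := (summable_multiTerm hq l).hasSum.map e he
  rw [andrews_identity hq l] at hp
  have h1 : (e ∘ fun n : andrewsIndex l => Ring.inverse (1 - q ^ (n : ℕ)))
      = fun n : andrewsIndex l => formalInv (1 - (PowerSeries.X : ℤ⟦X⟧) ^ (n : ℕ)) := by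
    funext n
    rw [Function.comp_apply, RingEquiv.map_ringInverse, map_sub, map_one, map_pow, heq,
      formalInv_eq_inverse (constantCoeff_one_sub_X_pow n.2.1)]
  have h2 : (e ∘ fun v : Fin l → ℕ => multiTerm q v)
      = fun v : Fin l → ℕ => (PowerSeries.X : ℤ⟦X⟧) ^ sumSqTails v *
          formalInv (∏ j, qFactorial (PowerSeries.X : ℤ⟦X⟧) (v j)) := by
    funext v
    have hf : ∀ m, e (qFactorial q m) = qFactorial PowerSeries.X m := fun m => by
      rw [← heq]
      exact map_qFactorial (e : AdicPowerSeries →+* ℤ⟦X⟧) q m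
    rw [Function.comp_apply, multiTerm_eq, map_mul, map_pow, heq, RingEquiv.map_ringInverse,
      map_prod, formalInv_eq_inverse (by simp [map_prod, constantCoeff_qFactorial_X])]
    simp only [hf]
  rw [h1] at hp
  rw [h2] at hs
  exact ⟨hp.multipliable, hs.summable, hp.tprod_eq.trans hs.tsum_eq.symm⟩

end FormalSeries

/-! ### The complex case and the conclusion -/

theorem andrews_identity_complex (l : ℕ) {q : ℂ} (hq : ‖q‖ < 1) :
    Multipliable (fun n : andrewsIndex l => (1 - q ^ (n : ℕ))⁻¹) ∧
      Summable (fun n : Fin l → ℕ => q ^ sumSqTails n / ∏ j, qFactorial q (n j)) ∧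
      ∏' n : andrewsIndex l, (1 - q ^ (n : ℕ))⁻¹ =
        ∑' n : Fin l → ℕ, q ^ sumSqTails n / ∏ j, qFactorial q (n j) := by
  have hp := multipliable_andrewsIndex hq l
  have hs := summable_multiTerm hq l
  have h := andrews_identity hq l
  simp only [multiTerm_eq, Ring.inverse_eq_inv', ← div_eq_mul_inv] at hp hs h
  exact ⟨hp, hs, h⟩

/-- Andrews' identity, first as an identity of formal power series in `q = X` with integer
coefficients (infinite products and sums converge coefficientwise, each coefficient being
eventually constant), and then as an identity of convergent products and series at every
complex `q` with `|q| < 1`. -/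
theorem mainTheorem4 (l : ℕ) (hl : 1 ≤ l) :
    (Multipliable (fun n : andrewsIndex l =>
          formalInv (1 - (PowerSeries.X : ℤ⟦X⟧) ^ (n : ℕ))) ∧
      Summable (fun n : Fin l → ℕ =>
          (PowerSeries.X : ℤ⟦X⟧) ^ sumSqTails n *
            formalInv (∏ j, qFactorial (PowerSeries.X : ℤ⟦X⟧) (n j))) ∧
      ∏' n : andrewsIndex l, formalInv (1 - (PowerSeries.X : ℤ⟦X⟧) ^ (n : ℕ)) =
        ∑' n : Fin l → ℕ, (PowerSeries.X : ℤ⟦X⟧) ^ sumSqTails n *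
          formalInv (∏ j, qFactorial (PowerSeries.X : ℤ⟦X⟧) (n j))) ∧
    ∀ q : ℂ, ‖q‖ < 1 →
      Multipliable (fun n : andrewsIndex l => (1 - q ^ (n : ℕ))⁻¹) ∧
      Summable (fun n : Fin l → ℕ => q ^ sumSqTails n / ∏ j, qFactorial q (n j)) ∧
      ∏' n : andrewsIndex l, (1 - q ^ (n : ℕ))⁻¹ =
        ∑' n : Fin l → ℕ, q ^ sumSqTails n / ∏ j, qFactorial q (n j) := by
  exact ⟨andrews_identity_powerSeries l, fun _ hq => andrews_identity_complex l hq⟩
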